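/- **Diagrams.** A diagram consists of a finite set of vertices and a finite set of half-lines, each attached to a vertex, together with an involution of the half-lines: a two-element orbit is an internal line (loops and multiple lines are allowed), a fixed point is an external line. Diagrams are considered up to isomorphism (vertices and external lines are unlabelled). Let $\mathcal A$ be the commutative $\mathbb Q$-algebra of finite formal linear combinations of diagrams, the product being disjoint union and $1$ the empty diagram; a formal series of diagrams is an element of $\mathcal A[[X]]$, where the power of $X$ counts vertices. A diagram is strongly connected (one-particle irreducible) if any two of its vertices are joined by a path and this remains true after removing any one internal line. **The operators $\mathbb H^{\mathrm{sc}}_n$.** For a diagram $D$ with $k$ external lines, $\mathbb H^{\mathrm{sc}}_n D$ is the sum, over all ways of choosing $n$ external lines of $D$ that stay external and connecting the remaining $k-n$ ones in pairs, of those resulting diagrams that are nonempty and strongly connected (so it is $0$ if $k<n$ or $k-n$ is odd, and $\mathbb H^{\mathrm{sc}}_n 1=0$). It is extended linearly to $\mathcal A$ and order by order in $X$ to formal series. **Statement.** Let $\zeta$ be the vertex with three external lines (of order $X$), $e^{\zeta}=\sum_{m\ge 0}\frac1{m!}\zeta^m$, let $\tau$ be the tadpole (also of order $X$), i.e. the one-vertex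 diagram obtained from $\zeta$ by connecting two of its three lines, and put $$\Gamma^{\mathrm{sc}}_1=\mathbb H^{\mathrm{sc}}_1(e^{\zeta}),\qquad \Sigma^{\mathrm{sc}}_2=\mathbb H^{\mathrm{sc}}_2(e^{\zeta}),$$ the sums of strongly connected diagrams with one and with two external lines. Then, as formal series of diagrams, $$\Gamma^{\mathrm{sc}}_1=3\,\tau+\sum_{k\ge 1}\frac1{k!}\,\mathbb H^{\mathrm{sc}}_1\!\left(\zeta\cdot(\Sigma^{\mathrm{sc}}_2)^k\right),$$ where at each order in $X$ only finitely many $k$ contribute to the sum. -/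

import Mathlib

noncomputable section

namespace Feynman

/-- A Feynman diagram: finitely many vertices, finitely many half-lines, each attached to a vertex,
and an involution on the half-lines.  A two-element orbit `{l, join l}` is an internal line
(possibly a loop at one vertex; multiple lines are allowed), a fixed point is an external line. -/
structure Diagram where
  Vert : Type
  Leg : Type
  finite_vert : Finite Vert
  finite_leg : Finite Leg
  root : Leg → Vert
  join : Leg → Leg
  join_join : Function.Involutive join

namespace Diagram

instance (D : Diagram) : Finite D.Vert := D.finite_vert
instance (D : Diagram) : Finite D.Leg := D.finite_leg

/-- Isomorphism of diagrams (neither vertices nor external lines carry labels). -/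
def Iso (D E : Diagram) : Prop :=
  ∃ (f : D.Vert ≃ E.Vert) (g : D.Leg ≃ E.Leg),
    (∀ l, E.root (g l) = f (D.root l)) ∧ ∀ l, E.join (g l) = g (D.join l)

theorem Iso.refl (D : Diagram) : Iso D D :=
  ⟨Equiv.refl _, Equiv.refl _, fun _ => rfl, fun _ => rfl⟩

theorem Iso.symm {D E : Diagram} : Iso D E → Iso E D := by
  rintro ⟨f, g, hr, hj⟩
  refine ⟨f.symm, g.symm, fun l => ?_, fun l => ?_⟩
  · rw [Equiv.eq_symm_apply, ← hr, Equiv.apply_symm_apply]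
  · rw [Equiv.eq_symm_apply, ← hj, Equiv.apply_symm_apply]

theorem Iso.trans {D E F : Diagram} : Iso D E → Iso E F → Iso D F := by
  rintro ⟨f, g, hr, hj⟩ ⟨f', g', hr', hj'⟩
  exact ⟨f.trans f', g.trans g', fun l => by simp [hr, hr'], fun l => by simp [hj, hj']⟩

instance setoid : Setoid Diagram := ⟨Iso, Iso.refl, Iso.symm, Iso.trans⟩

/-- The diagram without vertices. -/
def empty : Diagram where
  Vert := Empty
  Leg := Empty
  finite_vert := inferInstance
  finite_leg := inferInstance
  root := id
  join := id
  join_join := fun _ => rfl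

/-- The disjoint union of two diagrams. -/
def disjUnion (D E : Diagram) : Diagram where
  Vert := D.Vert ⊕ E.Vert
  Leg := D.Leg ⊕ E.Leg
  finite_vert := inferInstance
  finite_leg := inferInstance
  root := Sum.map D.root E.root
  join := Sum.map D.join E.join
  join_join := by
    rintro (l | l)
    · exact congrArg Sum.inl (D.join_join l)
    · exact congrArg Sum.inr (E.join_join l)

/-- A single vertex with `p` external lines. -/
def vertex (p : ℕ) : Diagram where
  Vert := Unit
  Leg := Fin p
  finite_vert := inferInstance
  finite_leg := inferInstance
  root := fun _ => ()
  join := id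
  join_join := fun _ => rfl

/-- The tadpole: a single vertex with three half-lines, two of which are joined to a loop. -/
def tadpole : Diagram where
  Vert := Unit
  Leg := Fin 3
  finite_vert := inferInstance
  finite_leg := inferInstance
  root := fun _ => ()
  join := Equiv.swap 1 2
  join_join := fun l => Equiv.swap_apply_self 1 2 l

/-- There is a path from `u` to `v` along lines whose half-lines are not in the removed set `R`. -/
def PathAvoiding (D : Diagram) (R : Set D.Leg) : D.Vert → D.Vert → Prop :=
  Relation.ReflTransGen fun u v => ∃ l, l ∉ R ∧ D.root l = u ∧ D.root (D.join l) = v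

/-- Any two vertices are connected by a path. -/
def IsConnected (D : Diagram) : Prop := ∀ u v, D.PathAvoiding ∅ u v

/-- The diagram is connected and remains so after removing any one internal line. (External lines
do not matter for paths between vertices.) -/
def IsStronglyConnected (D : Diagram) : Prop :=
  D.IsConnected ∧ ∀ l, D.join l ≠ l → ∀ u v, D.PathAvoiding {l, D.join l} u v

/-- A way of connecting some of the external lines of `D` in pairs, such that exactly `n` of them
remain external: an involution of the half-lines that extends the internal lines of `D` and has
exactly `n` fixed points. -/
def Joining (D : Diagram) (n : ℕ) : Type :=
  {t : D.Leg → D.Leg // Function.Involutive t ∧ (∀ l, D.join l ≠ l → t l = D.join l) ∧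
    Nat.card {l // t l = l} = n}

/-- The diagram that results from a joining. -/
def joined (D : Diagram) {n : ℕ} (t : D.Joining n) : Diagram :=
  { D with join := t.1, join_join := t.2.1 }

instance (D : Diagram) (n : ℕ) : Finite (D.Joining n) := by
  unfold Joining; infer_instance

theorem PathAvoiding.map {D E : Diagram} (f : D.Vert ≃ E.Vert) (g : D.Leg ≃ E.Leg)
    (hr : ∀ l, E.root (g l) = f (D.root l)) (hj : ∀ l, E.join (g l) = g (D.join l))
    {R : Set D.Leg} {S : Set E.Leg} (hS : ∀ l, g l ∈ S → l ∈ R) {u v : D.Vert}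
    (h : D.PathAvoiding R u v) : E.PathAvoiding S (f u) (f v) := by
  refine Relation.ReflTransGen.lift (r := fun u v => ∃ l, l ∉ R ∧ D.root l = u ∧
    D.root (D.join l) = v) f ?_ _ _ h
  rintro a b ⟨l, hl, ha, hb⟩
  exact ⟨g l, fun h => hl (hS l h), by rw [hr, ha], by rw [hj, hr, hb]⟩

theorem Iso.isStronglyConnected {D E : Diagram} (h : Iso D E) (hD : D.IsStronglyConnected) :
    E.IsStronglyConnected := by
  obtain ⟨f, g, hr, hj⟩ := h
  refine ⟨fun u v => ?_, fun l hl u v => ?_⟩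
  · have := (hD.1 (f.symm u) (f.symm v)).map (S := ∅) f g hr hj (by simp)
    simpa using this
  · obtain ⟨l, rfl⟩ := g.surjective l
    have h0 : D.join l ≠ l := fun h => hl (by rw [hj, h])
    have := (hD.2 l h0 (f.symm u) (f.symm v)).map (S := {g l, E.join (g l)}) f g hr hj
      (by intro m; simp [hj])
    simpa using this

theorem Iso.nonempty_vert {D E : Diagram} (h : Iso D E) (hD : Nonempty D.Vert) :
    Nonempty E.Vert := by
  obtain ⟨f, -⟩ := h
  exact hD.map f

theorem Iso.joinings {D E : Diagram} (h : Iso D E) (n : ℕ) :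
    ∃ e : D.Joining n ≃ E.Joining n, ∀ t, Iso (D.joined t) (E.joined (e t)) := by
  obtain ⟨f, g, hr, hj⟩ := h
  have key : ∀ t : D.Leg → D.Leg,
      (Function.Involutive t ∧ (∀ l, D.join l ≠ l → t l = D.join l) ∧
        Nat.card {l // t l = l} = n) ↔
      (Function.Involutive (g.conj t) ∧ (∀ l, E.join l ≠ l → g.conj t l = E.join l) ∧
        Nat.card {l // g.conj t l = l} = n) := by
    intro t
    refine and_congr ?_ (and_congr ?_ ?_)
    · constructor
      · intro h l; simp [Equiv.conj_apply, h _]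
      · intro h l; simpa [Equiv.conj_apply] using h (g l)
    · rw [← g.forall_congr_right]
      simp [Equiv.conj_apply, hj]
    · have : Nat.card {l // t l = l} = Nat.card {l // g.conj t l = l} :=
        Nat.card_congr (g.subtypeEquiv fun l => by simp [Equiv.conj_apply])
      rw [this]
  refine ⟨g.conj.subtypeEquiv key, fun t => ⟨f, g, hr, fun l => ?_⟩⟩
  exact congrArg (fun x => g (t.1 x)) (Equiv.symm_apply_apply g l)

end Diagram

/-- Isomorphism classes of diagrams, a commutative monoid under disjoint union. -/
def DiagramClass : Type 1 := Quotient Diagram.setoid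

namespace DiagramClass

/-- The isomorphism class of a diagram. -/
def mk (D : Diagram) : DiagramClass := Quotient.mk Diagram.setoid D

instance : Mul DiagramClass :=
  ⟨Quotient.map₂ Diagram.disjUnion (by
    rintro D D' ⟨f, g, hr, hj⟩ E E' ⟨f', g', hr', hj'⟩
    refine ⟨f.sumCongr f', g.sumCongr g', ?_, ?_⟩ <;> rintro (l | l)
    · exact congrArg Sum.inl (hr l)
    · exact congrArg Sum.inr (hr' l)
    · exact congrArg Sum.inl (hj l)
    · exact congrArg Sum.inr (hj' l))⟩

instance : One DiagramClass := ⟨mk Diagram.empty⟩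

instance : CommMonoid DiagramClass where
  mul_assoc := by
    rintro ⟨D⟩ ⟨E⟩ ⟨F⟩
    refine Quotient.sound ⟨Equiv.sumAssoc _ _ _, Equiv.sumAssoc _ _ _, ?_, ?_⟩ <;>
      rintro ((l | l) | l) <;> rfl
  mul_comm := by
    rintro ⟨D⟩ ⟨E⟩
    refine Quotient.sound ⟨Equiv.sumComm _ _, Equiv.sumComm _ _, ?_, ?_⟩ <;>
      rintro (l | l) <;> rfl
  one_mul := by
    rintro ⟨D⟩
    refine Quotient.sound ⟨Equiv.emptySum Empty _, Equiv.emptySum Empty _, ?_, ?_⟩ <;>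
      rintro (l | l) <;> first | exact l.elim | rfl
  mul_one := by
    rintro ⟨D⟩
    refine Quotient.sound ⟨Equiv.sumEmpty _ Empty, Equiv.sumEmpty _ Empty, ?_, ?_⟩ <;>
      rintro (l | l) <;> first | exact l.elim | rfl

end DiagramClass

/-- Finite linear combinations of diagrams, with disjoint union as product. -/
abbrev DiagramAlgebra : Type 1 := MonoidAlgebra ℚ DiagramClass

/-- A diagram as an element of the algebra of diagrams. -/
def diag (D : Diagram) : DiagramAlgebra := MonoidAlgebra.single (DiagramClass.mk D) 1

open scoped Classical in
/-- A diagram, if it is nonempty and strongly connected, and zero otherwise. -/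
def keepStronglyConnected (D : Diagram) : DiagramAlgebra :=
  if Nonempty D.Vert ∧ D.IsStronglyConnected then diag D else 0

theorem keepStronglyConnected_congr {D E : Diagram} (h : D.Iso E) :
    keepStronglyConnected D = keepStronglyConnected E := by
  have h1 : (Nonempty D.Vert ∧ D.IsStronglyConnected) ↔
      (Nonempty E.Vert ∧ E.IsStronglyConnected) :=
    ⟨fun k => ⟨h.nonempty_vert k.1, h.isStronglyConnected k.2⟩,
      fun k => ⟨h.symm.nonempty_vert k.1, h.symm.isStronglyConnected k.2⟩⟩
  have h2 : diag D = diag E := by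
    unfold diag
    rw [show DiagramClass.mk D = DiagramClass.mk E from Quotient.sound h]
  unfold keepStronglyConnected
  by_cases hE : Nonempty E.Vert ∧ E.IsStronglyConnected
  · rw [if_pos (h1.2 hE), if_pos hE, h2]
  · rw [if_neg (fun h => hE (h1.1 h)), if_neg hE]

/-- The sum of the strongly connected diagrams among those that arise from `D` by connecting all
but `n` external lines in pairs, over all possible ways of doing so. -/
def hscDiagram (n : ℕ) (D : Diagram) : DiagramAlgebra :=
  ∑ᶠ t : D.Joining n, keepStronglyConnected (D.joined t)

theorem hscDiagram_congr (n : ℕ) {D E : Diagram} (h : D.Iso E) :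
    hscDiagram n D = hscDiagram n E := by
  obtain ⟨e, he⟩ := h.joinings n
  exact finsum_eq_of_bijective e e.bijective fun t => keepStronglyConnected_congr (he t)

/-- The operator `H^sc_n` on isomorphism classes of diagrams. -/
def hscClass (n : ℕ) : DiagramClass → DiagramAlgebra :=
  Quotient.lift (hscDiagram n) (fun _ _ h => hscDiagram_congr n h)

/-- The linear operator `H^sc_n` on linear combinations of diagrams. -/
def hsc (n : ℕ) : DiagramAlgebra →ₗ[ℚ] DiagramAlgebra :=
  (Finsupp.linearCombination ℚ (hscClass n)).comp (MonoidAlgebra.coeffLinearEquiv ℚ).toLinearMap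

/-- Formal series of diagrams; the power of the variable `X` counts the vertices. -/
abbrev DiagramSeries : Type 1 := PowerSeries DiagramAlgebra

/-- The operator `H^sc_n` on formal series of diagrams, order by order. -/
def hscSeries (n : ℕ) (S : DiagramSeries) : DiagramSeries :=
  PowerSeries.mk fun m => hsc n (PowerSeries.coeff m S)

/-- The vertex with three external lines, as a formal series (of order one). -/
def cubicVertex : DiagramSeries :=
  PowerSeries.X * PowerSeries.C (diag (Diagram.vertex 3))

/-- The tadpole, as a formal series (of order one). -/
def tadpole : DiagramSeries :=
  PowerSeries.X * PowerSeries.C (diag Diagram.tadpole)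

/-- The exponential of the cubic vertex: at order `m` it is the product of `m` copies of the vertex,
divided by `m!`. -/
def expCubicVertex : DiagramSeries :=
  PowerSeries.mk fun m => ((m.factorial : ℚ)⁻¹) • diag (Diagram.vertex 3) ^ m

/-- The sum of strongly connected diagrams with one external line. -/
def gammaOne : DiagramSeries := hscSeries 1 expCubicVertex

/-- The sum of strongly connected diagrams with two external lines. -/
def sigmaTwo : DiagramSeries := hscSeries 2 expCubicVertex

/-- At each order only finitely many members of the family contribute. -/
def FormallySummable (f : ℕ → DiagramSeries) : Prop :=
  ∀ m, (Function.support fun k => PowerSeries.coeff m (f k)).Finite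

/-- The order-by-order sum of a formally summable family. -/
def formalSum (f : ℕ → DiagramSeries) : DiagramSeries :=
  PowerSeries.mk fun m => ∑ᶠ k, PowerSeries.coeff m (f k)

end Feynman

end

/-!
Both sides are expanded over labelled diagrams. Put `m` trivalent vertices on the label set `Fin m`;
then `m!` times the coefficient of `X ^ m` in `Γ^sc_1` is the sum, over all involutions `s` of the
half-lines with one fixed point, of the diagram of `s`, if it is strongly connected. On the other
side, a product of `k + 1` exponential generating series is a sum over colourings of the labels by
`Fin (k + 1)` (`coeff_prod_exponential`). The colour `0` stands for the factor `ζ`, the other colours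
for the factors `Σ^sc_2`. Exchanging the choice of the pieces with the choice of the final
involution `s` (`hsc_prod_sumJoinings`) shows that `m!` times the coefficient of `H^sc_1 (ζ Σ^k)` is
a sum over the same involutions, the diagram of `s` being counted once for each colouring such that
one vertex has the colour `0` and every other colour class is a *block*: a set of vertices on which
`s` induces a strongly connected diagram with two external lines (`coeff_hscSeries_mul_pow`,
`card_pieceJoining`).

It remains to see that a strongly connected diagram with one external line, attached to the vertex
`v₀`, splits in exactly one way into a single vertex and blocks. The single vertex is `v₀`, since a
block containing `v₀` would have only one line to the rest, a bridge (`notMem_of_isBlock`).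
Existence (`exists_isBlockPartition`): a set of vertices with two outgoing lines that is not a block
has a cut crossed by at most one line; each part has at least two outgoing lines as the diagram
has no bridge, so by counting each has exactly two, and induction applies.
Uniqueness (`IsBlockPartition.exists_subset`): if a block `p` of one partition lies in no block of
the other, every block of the other partition that meets `p` is contained in `p` and both its
outgoing lines end in `p`; hence no line leaves `p`, against connectedness.
If the partition has `n` blocks, there are `n!` colourings for `k = n` and none for `k ≠ n`, so the
factors `1 / k!` count every diagram once: `Γ^sc_1 = ∑ k, H^sc_1 (ζ Σ^k) / k!`, the sum starting
at `k = 0`. The term for `k = 0` is `H^sc_1 ζ = 3 τ`, because each of the three ways to join two of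
the lines of `ζ` gives a tadpole (`hscSeries_cubicVertex`).
-/

noncomputable section

namespace Feynman

/-! ### Products of diagrams and the operators on generators -/

theorem diag_mul (D E : Diagram) : diag D * diag E = diag (D.disjUnion E) := by
  unfold diag
  rw [MonoidAlgebra.single_mul_single, one_mul]
  rfl

theorem diag_empty : diag Diagram.empty = 1 := rfl

theorem diag_congr {D E : Diagram} (h : D.Iso E) : diag D = diag E := by
  unfold diag
  rw [show DiagramClass.mk D = DiagramClass.mk E from Quotient.sound h]

theorem hsc_diag (n : ℕ) (D : Diagram) : hsc n (diag D) = hscDiagram n D := by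
  unfold hsc diag
  rw [LinearMap.comp_apply, LinearEquiv.coe_coe, MonoidAlgebra.coeffLinearEquiv_apply,
    MonoidAlgebra.coeff_single, Finsupp.linearCombination_single, one_smul]
  rfl

namespace Diagram

/-- The disjoint union of a finite family of diagrams. -/
def sigma {ι : Type} [Finite ι] (D : ι → Diagram) : Diagram where
  Vert := Σ i, (D i).Vert
  Leg := Σ i, (D i).Leg
  finite_vert := inferInstance
  finite_leg := inferInstance
  root := Sigma.map id fun i => (D i).root
  join := Sigma.map id fun i => (D i).join
  join_join := by
    rintro ⟨i, l⟩
    exact congrArg (Sigma.mk i) ((D i).join_join l)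

/-- The diagram of three-valent vertices labelled by `V`, all of whose lines are external. -/
abbrev cubic (V : Type) [Finite V] : Diagram where
  Vert := V
  Leg := V × Fin 3
  finite_vert := inferInstance
  finite_leg := inferInstance
  root := Prod.fst
  join := id
  join_join := fun _ => rfl

end Diagram

/-- Splitting off the first summand of a sigma type over `Fin (n + 1)`. -/
def sigmaFinSucc {n : ℕ} (X : Fin (n + 1) → Type) :
    X 0 ⊕ (Σ i : Fin n, X i.succ) ≃ Σ i, X i where
  toFun := Sum.elim (fun x => ⟨0, x⟩) (fun x => ⟨x.1.succ, x.2⟩)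
  invFun := fun x => Fin.cases (motive := fun i => X i → X 0 ⊕ (Σ i : Fin n, X i.succ))
    Sum.inl (fun i x => Sum.inr ⟨i, x⟩) x.1 x.2
  left_inv := by rintro (x | ⟨i, x⟩) <;> rfl
  right_inv := by
    rintro ⟨i, x⟩
    induction i using Fin.cases <;> rfl

theorem prod_diag {n : ℕ} (D : Fin n → Diagram) : ∏ i, diag (D i) = diag (Diagram.sigma D) := by
  induction n with
  | zero =>
    rw [Fin.prod_univ_zero, ← diag_empty]
    refine diag_congr ⟨⟨Empty.elim, fun x => x.1.elim0, fun x => x.elim, fun x => x.1.elim0⟩,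
      ⟨Empty.elim, fun x => x.1.elim0, fun x => x.elim, fun x => x.1.elim0⟩, ?_, ?_⟩ <;>
      exact fun x => Empty.elim x
  | succ n ih =>
    rw [Fin.prod_univ_succ, ih, diag_mul]
    refine diag_congr ⟨sigmaFinSucc fun i => (D i).Vert, sigmaFinSucc fun i => (D i).Leg, ?_, ?_⟩ <;>
      rintro (l | ⟨i, l⟩) <;> rfl

theorem diag_vertex_pow (m : ℕ) :
    diag (Diagram.vertex 3) ^ m = diag (Diagram.cubic (Fin m)) := by
  have h := prod_diag fun _ : Fin m => Diagram.vertex 3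
  rw [Finset.prod_const, Finset.card_univ, Fintype.card_fin] at h
  rw [h]
  exact diag_congr ⟨Equiv.sigmaPUnit _, Equiv.sigmaEquivProd _ _, fun _ => rfl, fun _ => rfl⟩

theorem cubic_congr {V W : Type} [Finite V] [Finite W] (e : V ≃ W) :
    (Diagram.cubic V).Iso (Diagram.cubic W) :=
  ⟨e, e.prodCongr (Equiv.refl _), fun _ => rfl, fun _ => rfl⟩

theorem coeff_sigmaTwo (m : ℕ) : PowerSeries.coeff m sigmaTwo =
    ((m.factorial : ℚ)⁻¹) • hscDiagram 2 (Diagram.cubic (Fin m)) := by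
  simp only [sigmaTwo, hscSeries, expCubicVertex, PowerSeries.coeff_mk, map_smul, diag_vertex_pow,
    hsc_diag]

theorem coeff_gammaOne (m : ℕ) : PowerSeries.coeff m gammaOne =
    ((m.factorial : ℚ)⁻¹) • hscDiagram 1 (Diagram.cubic (Fin m)) := by
  simp only [gammaOne, hscSeries, expCubicVertex, PowerSeries.coeff_mk, map_smul, diag_vertex_pow,
    hsc_diag]

/-- There are three ways to join two of the three lines, and each gives a tadpole. -/
theorem hscDiagram_vertex : hscDiagram 1 (Diagram.vertex 3) = (3 : ℚ) • diag Diagram.tadpole := by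
  have key : ∀ t : Fin 3 → Fin 3, Function.Involutive t → Fintype.card {l // t l = l} = 1 →
      ∃ g : Equiv.Perm (Fin 3), ∀ l, (Equiv.swap 1 2 : Equiv.Perm (Fin 3)) (g l) = g (t l) := by
    unfold Function.Involutive
    decide
  have hfix : ∀ t : Fin 3 → Fin 3, Nat.card {l // t l = l} = Fintype.card {l // t l = l} :=
    fun t => Nat.card_eq_fintype_card
  have hcard : Nat.card ((Diagram.vertex 3).Joining 1) = 3 := by
    have : Fintype.card {t : Fin 3 → Fin 3 // (∀ l, t (t l) = l) ∧
        Fintype.card {l // t l = l} = 1} = 3 := by decide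
    refine Eq.trans ?_ this
    rw [← Nat.card_eq_fintype_card]
    refine Nat.card_congr (Equiv.subtypeEquivRight fun t => ?_)
    refine and_congr Iff.rfl ⟨fun h => (hfix t).symm.trans h.2,
      fun h => ⟨fun l hl => (hl rfl).elim, (hfix t).trans h⟩⟩
  have hconst : ∀ t : (Diagram.vertex 3).Joining 1,
      keepStronglyConnected ((Diagram.vertex 3).joined t) = diag Diagram.tadpole := by
    intro t
    have hiso : ((Diagram.vertex 3).joined t).Iso Diagram.tadpole := by
      obtain ⟨g, hg⟩ := key t.1 t.2.1 ((hfix t.1).symm.trans t.2.2.2)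
      exact ⟨Equiv.refl _, g, fun _ => rfl, hg⟩
    rw [keepStronglyConnected_congr hiso, keepStronglyConnected, if_pos]
    exact ⟨⟨()⟩, fun _ _ => Relation.ReflTransGen.refl, fun _ _ _ _ => Relation.ReflTransGen.refl⟩
  unfold hscDiagram
  have := Fintype.ofFinite ((Diagram.vertex 3).Joining 1)
  rw [finsum_eq_sum_of_fintype, Finset.sum_congr rfl fun t _ => hconst t, Finset.sum_const,
    Finset.card_univ, ← Nat.card_eq_fintype_card, hcard]
  module

theorem hscSeries_cubicVertex : hscSeries 1 cubicVertex = (3 : ℚ) • tadpole := by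
  ext1 m
  simp only [hscSeries, cubicVertex, tadpole, PowerSeries.coeff_mk, PowerSeries.coeff_smul]
  rcases m with _ | m
  · simp
  · rw [PowerSeries.coeff_succ_X_mul, PowerSeries.coeff_succ_X_mul, PowerSeries.coeff_C,
      PowerSeries.coeff_C]
    split_ifs
    · rw [hsc_diag, hscDiagram_vertex]
    · simp

/-! ### Products of exponential generating series -/

open Finset in
/-- The product of exponential generating series counts the ways to distribute the labels. -/
theorem coeff_prod_exponential {R : Type*} [CommRing R] [Algebra ℚ R] {n : ℕ}
    (f : Fin n → ℕ → R) (V : Type) [Fintype V] [DecidableEq V] :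
    PowerSeries.coeff (Fintype.card V)
        (∏ i, PowerSeries.mk fun j => ((j.factorial : ℚ)⁻¹) • f i j) =
      (((Fintype.card V).factorial : ℚ)⁻¹) •
        ∑ c : V → Fin n, ∏ i, f i #{v | c v = i} := by
  induction n generalizing V with
  | zero =>
    rcases isEmpty_or_nonempty V with hV | hV
    · simp
    · have : IsEmpty (V → Fin 0) := ⟨fun c => (c hV.some).elim0⟩
      simp [PowerSeries.coeff_one, Fintype.card_ne_zero]
  | succ n ih =>
    -- group the colourings according to the set `S` of labels of the first colour
    have hfib : ∀ S : Finset V,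
        ∑ c : V → Fin (n + 1) with ({v | c v = 0} : Finset V) = S, ∏ i, f i #{v | c v = i} =
        f 0 #S * ∑ c : {v // v ∉ S} → Fin n, ∏ i, f i.succ #{v | c v = i} := by
      intro S
      rw [mul_sum]
      symm
      refine sum_bij (fun c _ v => if h : v ∈ S then 0 else (c ⟨v, h⟩).succ) ?_ ?_ ?_ ?_
      · intro c _
        rw [mem_filter]
        refine ⟨mem_univ _, ?_⟩
        ext v
        by_cases h : v ∈ S <;> simp [h]
      · intro c _ c' _ h
        funext ⟨v, hv⟩
        have := congrFun h v
        simpa [hv] using this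
      · intro c hc
        rw [mem_filter] at hc
        have hc' : ∀ v, c v = 0 ↔ v ∈ S := fun v => by simp [← hc.2]
        refine ⟨fun v => (c v.1).pred fun h => v.2 ((hc' _).1 h), mem_univ _, ?_⟩
        funext v
        by_cases h : v ∈ S
        · simp [h, (hc' v).2 h]
        · simp [h]
      · intro c _
        rw [Fin.prod_univ_succ]
        congr 2
        · congr 1
          ext v
          by_cases h : v ∈ S <;> simp [h]
        · funext i
          congr 1
          refine card_bij (fun v _ => v.1) ?_ (fun _ _ _ _ h => Subtype.ext h) ?_
          · rintro ⟨v, hv⟩ h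
            simpa [hv] using h
          · intro v hv
            by_cases h : v ∈ S
            · simp [h, Fin.ext_iff] at hv
            · exact ⟨⟨v, h⟩, by simpa [h] using hv, rfl⟩
    rw [Fin.prod_univ_succ, PowerSeries.coeff_mul, ← sum_fiberwise univ
      (fun c : V → Fin (n + 1) => ({v | c v = 0} : Finset V)), sum_congr rfl fun S _ => hfib S]
    have hIH : ∀ S : Finset V, f 0 #S * ∑ c : {v // v ∉ S} → Fin n, ∏ i, f i.succ #{v | c v = i} =
        f 0 #S * (((Fintype.card V - #S).factorial : ℚ) • PowerSeries.coeff (Fintype.card V - #S)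
          (∏ i : Fin n, PowerSeries.mk fun j => ((j.factorial : ℚ)⁻¹) • f i.succ j)) := by
      intro S
      have h1 := ih (fun i => f i.succ) {v // v ∉ S}
      have h2 : Fintype.card {v // v ∉ S} = Fintype.card V - #S := by
        rw [Fintype.card_subtype_compl, Fintype.card_coe]
      rw [h2] at h1
      rw [h1, smul_smul, mul_inv_cancel₀ (by positivity), one_smul]
    rw [sum_congr rfl fun S _ => hIH S, ← Finset.powerset_univ,
      sum_powerset_apply_card (fun j => f 0 j * (((Fintype.card V - j).factorial : ℚ) •
        PowerSeries.coeff (Fintype.card V - j)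
          (∏ i : Fin n, PowerSeries.mk fun j => ((j.factorial : ℚ)⁻¹) • f i.succ j))),
      Finset.card_univ, Finset.Nat.sum_antidiagonal_eq_sum_range_succ_mk, smul_sum]
    refine sum_congr rfl fun j hj => ?_
    have hj' : j ≤ Fintype.card V := by simpa [Nat.lt_succ_iff] using hj
    rw [PowerSeries.coeff_mk, smul_mul_assoc, ← Nat.cast_smul_eq_nsmul ℚ, mul_smul_comm, smul_smul,
      smul_smul]
    congr 1
    rw [← Nat.choose_mul_factorial_mul_factorial hj']
    have := Nat.choose_pos hj'
    push_cast
    field_simp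

/-! ### Cuts, blocks and block partitions -/

namespace Diagram

variable {D : Diagram}

/-- The half-lines at a vertex of `A` whose partner is attached to a vertex of `B`. -/
def cross (D : Diagram) (A B : Set D.Vert) : Set D.Leg :=
  {l | D.root l ∈ A ∧ D.root (D.join l) ∈ B}

/-- The half-lines that become external lines of the part of the diagram on `p`: those which are
external already, and those that are joined to a half-line outside `p`. -/
def outer (D : Diagram) (p : Set D.Vert) : Set D.Leg :=
  {l | D.root l ∈ p ∧ (D.join l = l ∨ D.root (D.join l) ∉ p)}

/-- A nonempty set of vertices on which the diagram induces a strongly connected diagram with two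
external lines. Strong connectedness is expressed through cuts. -/
structure IsBlock (D : Diagram) (p : Set D.Vert) : Prop where
  nonempty : p.Nonempty
  ncard_outer : (D.outer p).ncard = 2
  cross_nontrivial : ∀ A ⊆ p, A.Nonempty → A ≠ p → (D.cross A (p \ A)).Nontrivial

/-- `P` is a partition of `C` into blocks. -/
structure IsBlockPartition (D : Diagram) (C : Set D.Vert) (P : Set (Set D.Vert)) : Prop where
  isBlock : ∀ p ∈ P, D.IsBlock p
  sUnion_eq : ⋃₀ P = C
  eq_of_mem : ∀ p ∈ P, ∀ q ∈ P, ∀ v, v ∈ p → v ∈ q → p = q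

theorem PathAvoiding.mem_of_closed {R : Set D.Leg} {A : Set D.Vert}
    (hA : ∀ l, l ∉ R → D.root l ∈ A → D.root (D.join l) ∈ A) {u v : D.Vert}
    (h : D.PathAvoiding R u v) (hu : u ∈ A) : v ∈ A := by
  induction h with
  | refl => exact hu
  | tail _ h ih =>
    obtain ⟨l, hl, rfl, rfl⟩ := h
    exact hA l hl ih

/-- The cut form of strong connectedness: every cut of the vertex set is crossed by at least two
internal lines. -/
theorem isStronglyConnected_iff : D.IsStronglyConnected ↔
    ∀ A : Set D.Vert, A.Nonempty → A ≠ Set.univ → (D.cross A Aᶜ).Nontrivial := by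
  constructor
  · rintro ⟨h0, h1⟩ A ⟨u, hu⟩ hA
    obtain ⟨v, hv⟩ := (Set.ne_univ_iff_exists_notMem A).1 hA
    by_contra hn
    rw [Set.not_nontrivial_iff] at hn
    rcases hn.eq_empty_or_singleton with h | ⟨l, h⟩
    · refine hv ((h0 u v).mem_of_closed (fun l _ hl => ?_) hu)
      by_contra hl'
      exact (h ▸ (⟨hl, hl'⟩ : l ∈ D.cross A Aᶜ) : l ∈ (∅ : Set D.Leg))
    · have hl : l ∈ D.cross A Aᶜ := h ▸ rfl
      refine hv ((h1 l (fun h => ?_) u v).mem_of_closed (fun l' hl' hlA => ?_) hu)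
      · have h2 := hl.2
        rw [h] at h2
        exact h2 hl.1
      · by_contra hl''
        have : l' ∈ ({l} : Set D.Leg) := h ▸ (⟨hlA, hl''⟩ : l' ∈ D.cross A Aᶜ)
        exact hl' (Or.inl this)
  · intro h
    have key : ∀ R : Set D.Leg, (∀ A, (D.cross A Aᶜ) ⊆ R → (D.cross A Aᶜ).Subsingleton) →
        ∀ u v, D.PathAvoiding R u v := by
      intro R hR u v
      by_contra hv
      refine Set.not_nontrivial_iff.2 (hR {w | D.PathAvoiding R u w} ?_)
        (h _ ⟨u, Relation.ReflTransGen.refl⟩ ((Set.ne_univ_iff_exists_notMem _).2 ⟨v, hv⟩))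
      intro l hl
      by_contra hlR
      exact hl.2 (Relation.ReflTransGen.tail hl.1 ⟨l, hlR, rfl, rfl⟩)
    refine ⟨key ∅ fun A hA => ?_, fun l _ => key _ fun A hA => ?_⟩
    · rw [Set.subset_empty_iff.1 hA]
      exact Set.subsingleton_empty
    · -- only one of the two halves of the line `{l, join l}` leaves `A`
      intro a ha b hb
      rcases hA ha with rfl | h1 <;> rcases hA hb with h2 | h2
      · exact h2.symm
      · rw [Set.mem_singleton_iff] at h2
        subst h2
        exact (ha.2 hb.1).elim
      · subst h2
        rw [Set.mem_singleton_iff] at h1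
        subst h1
        exact (hb.2 ha.1).elim
      · rw [Set.mem_singleton_iff] at h1 h2
        rw [h1, h2]

theorem IsStronglyConnected.exists_mem_cross (hsc : D.IsStronglyConnected) {A : Set D.Vert}
    (hA : A.Nonempty) (hA' : A ≠ Set.univ) : ∃ l, D.root l ∈ A ∧ D.root (D.join l) ∉ A :=
  (isStronglyConnected_iff.1 hsc A hA hA').nonempty

theorem two_le_ncard_outer (hsc : D.IsStronglyConnected) {A : Set D.Vert}
    (hA : A.Nonempty) (hA' : A ≠ Set.univ) :
    2 ≤ (D.outer A).ncard := by
  have h := isStronglyConnected_iff.1 hsc A hA hA'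
  have h' : (D.outer A).Nontrivial := h.mono fun l hl => ⟨hl.1, Or.inr hl.2⟩
  exact (Set.one_lt_ncard_iff_nontrivial).2 h'

/-- By induction on the size of `C`: a set of vertices with two outgoing lines that is not a block
splits into two smaller sets with two outgoing lines each. -/
theorem exists_isBlockPartition {v₀ : D.Vert} (hsc : D.IsStronglyConnected) (C : Set D.Vert)
    (hC : v₀ ∉ C) (hne : C.Nonempty)
    (h2 : (D.outer C).ncard = 2) : ∃ P, D.IsBlockPartition C P := by
  induction hn : C.ncard using Nat.strong_induction_on generalizing C with
  | _ n ih =>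
  subst hn
  by_cases hb : D.IsBlock C
  · refine ⟨{C}, ?_, Set.sUnion_singleton C, ?_⟩
    · rintro p rfl
      exact hb
    · rintro p rfl q rfl _ _ _
      rfl
  obtain ⟨A, hAC, hA, hA', hcross⟩ : ∃ A ⊆ C, A.Nonempty ∧ A ≠ C ∧
      (D.cross A (C \ A)).Subsingleton := by
    by_contra hcon
    push Not at hcon
    exact hb ⟨hne, h2, fun A h h' h'' => hcon A h h' h''⟩
  set B := C \ A with hB
  have hBne : B.Nonempty := Set.sdiff_nonempty.2 fun h => hA' (hAC.antisymm h)
  have hAu : A ≠ Set.univ := fun h => hC (hAC (h ▸ Set.mem_univ _))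
  have hBu : B ≠ Set.univ := fun h => hC (h ▸ Set.mem_univ v₀ : v₀ ∈ B).1
  have hAo := two_le_ncard_outer hsc hA hAu
  have hBo := two_le_ncard_outer hsc hBne hBu
  -- lines leaving `A` or `B` leave `C`, or belong to the one line between `A` and `B`
  have hsum : (D.outer A).ncard + (D.outer B).ncard ≤ 4 := by
    have hdisj : Disjoint (D.outer A) (D.outer B) :=
      Set.disjoint_left.2 fun l h h' => h'.1.2 h.1
    rw [← Set.ncard_union_eq hdisj]
    have hsub : D.outer A ∪ D.outer B ⊆ D.outer C ∪ (D.cross A B ∪ D.join '' D.cross A B) := by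
      rintro l (⟨h, h'⟩ | ⟨h, h'⟩)
      · by_cases hl : D.join l = l ∨ D.root (D.join l) ∉ C
        · exact Or.inl ⟨hAC h, hl⟩
        · push Not at hl
          exact Or.inr (Or.inl ⟨h, hl.2, h'.resolve_left hl.1⟩)
      · by_cases hl : D.join l = l ∨ D.root (D.join l) ∉ C
        · exact Or.inl ⟨h.1, hl⟩
        · push Not at hl
          refine Or.inr (Or.inr ⟨D.join l, ⟨?_, ?_⟩, D.join_join l⟩)
          · by_contra hA
            exact h'.resolve_left hl.1 ⟨hl.2, hA⟩
          · rwa [D.join_join l]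
    refine (Set.ncard_le_ncard hsub).trans ((Set.ncard_union_le _ _).trans ?_)
    have h3 := Set.ncard_union_le (D.cross A B) (D.join '' D.cross A B)
    have h4 := Set.ncard_image_le (f := D.join) (Set.toFinite (D.cross A B))
    have h5 := Set.ncard_le_one_iff_subsingleton.2 hcross
    omega
  have hlt : ∀ E ⊆ C, E ≠ C → E.ncard < C.ncard := fun E h h' =>
    Set.ncard_lt_ncard (h.ssubset_of_ne h')
  obtain ⟨P, hP⟩ := ih _ (hlt A hAC hA') A (fun h => hC (hAC h)) hA (by omega) rfl
  obtain ⟨Q, hQ⟩ := ih _ (hlt B Set.sdiff_subset fun h => by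
    obtain ⟨a, ha⟩ := hA
    exact (h ▸ hAC ha : a ∈ B).2 ha) B (fun h => hC h.1) hBne (by omega) rfl
  have hPA : ∀ p ∈ P, ∀ v ∈ p, v ∈ A := fun p hp v hv =>
    hP.sUnion_eq ▸ Set.mem_sUnion_of_mem hv hp
  have hQB : ∀ q ∈ Q, ∀ v ∈ q, v ∈ B := fun q hq v hv =>
    hQ.sUnion_eq ▸ Set.mem_sUnion_of_mem hv hq
  refine ⟨P ∪ Q, ?_, ?_, ?_⟩
  · rintro p (hp | hp)
    exacts [hP.isBlock p hp, hQ.isBlock p hp]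
  · rw [Set.sUnion_union, hP.sUnion_eq, hQ.sUnion_eq, hB, Set.union_sdiff_cancel hAC]
  · rintro p (hp | hp) q (hq | hq) v hvp hvq
    · exact hP.eq_of_mem p hp q hq v hvp hvq
    · exact ((hQB q hq v hvq).2 (hPA p hp v hvp)).elim
    · exact ((hQB p hp v hvp).2 (hPA q hq v hvq)).elim
    · exact hQ.eq_of_mem p hp q hq v hvp hvq

/-- The set of all vertices but `v₀` has two outgoing lines: the third half-line of `v₀` is the
external line, and there are at least two by strong connectedness. -/
theorem exists_isBlockPartition_compl {v₀ : D.Vert} (hsc : D.IsStronglyConnected)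
    (hv₀ : ∀ l, D.join l = l → D.root l = v₀)
    (hfix : ∃ l, D.join l = l) (hdeg : {l | D.root l = v₀}.ncard = 3) :
    ∃ P, D.IsBlockPartition {v₀}ᶜ P := by
  rcases Set.eq_empty_or_nonempty ({v₀}ᶜ : Set D.Vert) with h | h
  · exact ⟨∅, by simp, by simp [h], by simp⟩
  refine exists_isBlockPartition (v₀ := v₀) hsc {v₀}ᶜ (by simp) h (le_antisymm ?_ ?_)
  · -- the lines leaving the complement of `v₀` end at one of the two other half-lines of `v₀`
    obtain ⟨l₀, hl₀⟩ := hfix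
    have hsub : D.outer {v₀}ᶜ ⊆ D.join '' ({l | D.root l = v₀} \ {l₀}) := by
      rintro l ⟨h1, h2⟩
      have h3 : D.root (D.join l) = v₀ := by
        rcases h2 with h2 | h2
        · exact (h1 (hv₀ l h2)).elim
        · simpa using h2
      refine ⟨D.join l, ⟨h3, fun h4 => ?_⟩, D.join_join l⟩
      rw [Set.mem_singleton_iff] at h4
      have h5 : l = l₀ := by rw [← D.join_join l, h4, hl₀]
      exact h1 (by rw [h5]; exact hv₀ l₀ hl₀)
    refine (Set.ncard_le_ncard hsub).trans ((Set.ncard_image_le (Set.toFinite _)).trans ?_)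
    have h6 : l₀ ∈ {l | D.root l = v₀} := hv₀ l₀ hl₀
    rw [Set.ncard_sdiff_singleton_of_mem h6, hdeg]
  · refine two_le_ncard_outer hsc h fun h => ?_
    exact (h ▸ Set.mem_univ v₀ : v₀ ∈ ({v₀}ᶜ : Set D.Vert)) rfl

/-- If `p` lies in no block of `Q`, then all blocks of `Q` that meet `p` lie in `p` and are joined
to vertices of `p` only, so that no line leaves `p`. -/
theorem IsBlockPartition.exists_subset {v₀ : D.Vert} (hsc : D.IsStronglyConnected)
    {P Q : Set (Set D.Vert)} (hP : D.IsBlockPartition {v₀}ᶜ P)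
    (hQ : D.IsBlockPartition {v₀}ᶜ Q) {p : Set D.Vert} (hp : p ∈ P) : ∃ q ∈ Q, p ⊆ q := by
  by_contra! hcon
  have hPv : v₀ ∉ p := fun h => (hP.sUnion_eq ▸ Set.mem_sUnion_of_mem h hp :
    v₀ ∈ ({v₀}ᶜ : Set D.Vert)) rfl
  have hQv : ∀ q ∈ Q, v₀ ∉ q := fun q hq h => (hQ.sUnion_eq ▸ Set.mem_sUnion_of_mem h hq :
    v₀ ∈ ({v₀}ᶜ : Set D.Vert)) rfl
  -- a block not contained in another one that it meets receives both outgoing lines of the latter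
  have key : ∀ p q : Set D.Vert, D.IsBlock p → D.IsBlock q → (p ∩ q).Nonempty → ¬ p ⊆ q →
      ∀ l ∈ D.outer q, D.root (D.join l) ∈ p := by
    intro p q hp hq hpq hnot l hl
    have hnt := hp.cross_nontrivial (p ∩ q) Set.inter_subset_left hpq
      fun h => hnot (Set.inter_eq_left.1 h)
    have hsub : D.cross (p ∩ q) (p \ (p ∩ q)) ⊆ D.outer q := fun l hl =>
      ⟨hl.1.2, Or.inr fun h => hl.2.2 ⟨hl.2.1, h⟩⟩
    have heq := Set.eq_of_subset_of_ncard_le hsub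
      (hq.ncard_outer.trans_le (Set.one_lt_ncard_iff_nontrivial.2 hnt))
    rw [← heq] at hl
    exact hl.2.1
  have houter : ∀ (q : Set D.Vert) l, D.root l ∈ q → D.root (D.join l) ∈ q ∨ l ∈ D.outer q :=
    fun q l hl => or_iff_not_imp_left.2 fun h => ⟨hl, Or.inr h⟩
  have hsubset : ∀ q ∈ Q, (p ∩ q).Nonempty → q ⊆ p := by
    intro q hq hpq
    by_contra hnot
    obtain ⟨l, hl, hl'⟩ := hsc.exists_mem_cross (A := p ∪ q)
      (hpq.mono fun v hv => Or.inl hv.1)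
      fun h => (h ▸ Set.mem_univ v₀ : v₀ ∈ p ∪ q).elim hPv (hQv q hq)
    rcases hl with hl | hl
    · rcases houter p l hl with h | h
      · exact hl' (Or.inl h)
      · exact hl' (Or.inr (key q p (hQ.isBlock q hq) (hP.isBlock p hp)
          (Set.inter_comm p q ▸ hpq) hnot l h))
    · rcases houter q l hl with h | h
      · exact hl' (Or.inr h)
      · exact hl' (Or.inl (key p q (hP.isBlock p hp) (hQ.isBlock q hq) hpq (hcon q hq) l h))
  obtain ⟨l, hl, hl'⟩ := hsc.exists_mem_cross (hP.isBlock p hp).nonempty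
    fun h => hPv (h ▸ Set.mem_univ v₀)
  obtain ⟨q, hq, hlq⟩ : D.root l ∈ ⋃₀ Q := by
    rw [hQ.sUnion_eq]
    exact fun h => hPv (h ▸ hl)
  have hpq : (p ∩ q).Nonempty := ⟨_, hl, hlq⟩
  rcases houter q l hlq with h | h
  · exact hl' (hsubset q hq hpq h)
  · exact hl' (key p q (hP.isBlock p hp) (hQ.isBlock q hq) hpq (hcon q hq) l h)

theorem IsBlockPartition.subset {v₀ : D.Vert} (hsc : D.IsStronglyConnected)
    {P Q : Set (Set D.Vert)} (hP : D.IsBlockPartition {v₀}ᶜ P)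
    (hQ : D.IsBlockPartition {v₀}ᶜ Q) : P ⊆ Q := by
  intro p hp
  obtain ⟨q, hq, hpq⟩ := hP.exists_subset hsc hQ hp
  obtain ⟨p', hp', hqp⟩ := hQ.exists_subset hsc hP hq
  obtain ⟨v, hv⟩ := (hP.isBlock p hp).nonempty
  obtain rfl := hP.eq_of_mem p hp p' hp' v hv (hqp (hpq hv))
  rwa [hpq.antisymm hqp]

/-- A block cannot contain the vertex of the only external line: its second outgoing line would be
the only line that leaves it. -/
theorem notMem_of_isBlock {v₀ : D.Vert} (hsc : D.IsStronglyConnected)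
    (hfix : ∃ l, D.join l = l ∧ D.root l = v₀) {p : Set D.Vert}
    (hp : D.IsBlock p) (hpu : p ≠ Set.univ) : v₀ ∉ p := by
  obtain ⟨l₀, hl₀, rfl⟩ := hfix
  intro hmem
  have h := isStronglyConnected_iff.1 hsc p hp.nonempty hpu
  have hsub : D.cross p pᶜ ⊆ D.outer p \ {l₀} := by
    intro l hl
    refine ⟨⟨hl.1, Or.inr hl.2⟩, ?_⟩
    rintro rfl
    exact hl.2 (hl₀.symm ▸ hmem)
  have h1 := Set.ncard_le_ncard hsub
  have h2 := Set.one_lt_ncard_iff_nontrivial.2 h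
  have h3 : l₀ ∈ D.outer p := ⟨hmem, Or.inl hl₀⟩
  rw [Set.ncard_sdiff_singleton_of_mem h3, hp.ncard_outer] at h1
  omega

/-- A colouring of the vertices for which one vertex has the colour `0`, and the other colours mark
blocks. -/
def IsBlockColoring (D : Diagram) {k : ℕ} (c : D.Vert → Fin (k + 1)) : Prop :=
  Nat.card {v // c v = 0} = 1 ∧ ∀ i : Fin k, D.IsBlock {v | c v = i.succ}

/-- The block colourings of a strongly connected diagram with one external line, which is attached
to a vertex of valency three, are the numberings of one and the same partition. -/
theorem exists_card_isBlockColoring (hsc : D.IsStronglyConnected)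
    (hfix : Nat.card {l // D.join l = l} = 1)
    (hdeg : ∀ v, {l | D.root l = v}.ncard = 3) :
    ∃ n : ℕ, n ≤ Nat.card D.Vert ∧ ∀ k : ℕ,
      Nat.card {c : D.Vert → Fin (k + 1) // D.IsBlockColoring c} =
        if k = n then k.factorial else 0 := by
  obtain ⟨⟨l₀, hl₀⟩, huniq⟩ := (Nat.card_eq_one_iff_exists).1 hfix
  set v₀ := D.root l₀ with hv₀def
  have hv₀ : ∀ l, D.join l = l → D.root l = v₀ := fun l hl => by
    rw [hv₀def, show l = l₀ from congrArg Subtype.val (huniq ⟨l, hl⟩)]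
  obtain ⟨P, hP⟩ := exists_isBlockPartition_compl hsc hv₀ ⟨l₀, hl₀⟩ (hdeg v₀)
  have hzero : ∀ {k : ℕ} (c : D.Vert → Fin (k + 1)), D.IsBlockColoring c →
      ∀ v, c v = 0 ↔ v = v₀ := by
    intro k c hc
    obtain ⟨⟨w, hw⟩, hw'⟩ := (Nat.card_eq_one_iff_exists).1 hc.1
    have h0 : c v₀ = 0 := by
      by_contra hne
      obtain ⟨i, hi⟩ := Fin.exists_succ_eq.2 hne
      refine notMem_of_isBlock hsc ⟨l₀, hl₀, rfl⟩ (hc.2 i) (fun h => ?_) hi.symm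
      have : w ∈ {v | c v = i.succ} := h ▸ Set.mem_univ w
      exact Fin.succ_ne_zero i (this.symm.trans hw)
    refine fun v => ⟨fun hv => ?_, fun hv => hv ▸ h0⟩
    exact congrArg Subtype.val ((hw' ⟨v, hv⟩).trans (hw' ⟨v₀, h0⟩).symm)
  have hpart : ∀ {k : ℕ} (c : D.Vert → Fin (k + 1)), D.IsBlockColoring c →
      Set.range (fun i : Fin k => {v | c v = i.succ}) = P := by
    intro k c hc
    have hpart' : D.IsBlockPartition {v₀}ᶜ (Set.range fun i : Fin k => {v | c v = i.succ}) := by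
      refine ⟨?_, ?_, ?_⟩
      · rintro _ ⟨i, rfl⟩
        exact hc.2 i
      · ext v
        rw [Set.sUnion_range, Set.mem_iUnion, Set.mem_compl_iff, Set.mem_singleton_iff,
          ← hzero c hc v, ← Ne, ← Fin.exists_succ_eq]
        exact exists_congr fun i => eq_comm
      · rintro _ ⟨i, rfl⟩ _ ⟨j, rfl⟩ v hi hj
        obtain rfl : i = j := Fin.succ_injective k (hi.symm.trans hj)
        rfl
    exact (hpart'.subset hsc hP).antisymm (hP.subset hsc hpart')
  have hcard : ∀ k : ℕ, Nat.card {c : D.Vert → Fin (k + 1) // D.IsBlockColoring c} =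
      Nat.card (Fin k ≃ P) := by
    intro k
    have hinj : ∀ c : {c : D.Vert → Fin (k + 1) // D.IsBlockColoring c},
        Function.Bijective fun i : Fin k => (⟨{v | c.1 v = i.succ},
          hpart c.1 c.2 ▸ Set.mem_range_self i⟩ : P) := by
      refine fun c => ⟨fun i j hij => ?_, fun ⟨p, hp⟩ => ?_⟩
      · obtain ⟨v, hv⟩ := (c.2.2 i).nonempty
        have hset : {v | c.1 v = i.succ} = {v | c.1 v = j.succ} := congrArg Subtype.val hij
        have hv' : v ∈ {v | c.1 v = j.succ} := hset ▸ hv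
        exact Fin.succ_injective k (hv.symm.trans hv')
      · rw [← hpart c.1 c.2] at hp
        obtain ⟨i, rfl⟩ := hp
        exact ⟨i, rfl⟩
    refine Nat.card_congr (Equiv.ofBijective (fun c => Equiv.ofBijective _ (hinj c)) ⟨?_, ?_⟩)
    · intro c c' h
      have hset : ∀ i : Fin k, {v | c.1 v = i.succ} = {v | c'.1 v = i.succ} := fun i =>
        congrArg Subtype.val (DFunLike.congr_fun h i)
      refine Subtype.ext (funext fun v => ?_)
      by_cases hv : c.1 v = 0
      · rw [hv, (hzero c'.1 c'.2 v).2 ((hzero c.1 c.2 v).1 hv)]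
      · obtain ⟨i, hi⟩ := Fin.exists_succ_eq.2 hv
        have : v ∈ {v | c'.1 v = i.succ} := hset i ▸ hi.symm
        rw [← hi, this]
    · intro e
      have hex : ∀ v, ∃ j : Fin (k + 1), (v = v₀ → j = 0) ∧
          ∀ h : v ≠ v₀, ∃ i : Fin k, j = i.succ ∧ v ∈ (e i).1 := by
        intro v
        by_cases hv : v = v₀
        · exact ⟨0, fun _ => rfl, fun h => (h hv).elim⟩
        · obtain ⟨p, hp, hvp⟩ : v ∈ ⋃₀ P := by
            rw [hP.sUnion_eq]
            exact hv
          exact ⟨(e.symm ⟨p, hp⟩).succ, fun h => (hv h).elim, fun _ => ⟨_, rfl, by simpa using hvp⟩⟩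
      choose c hc hc' using hex
      have hne : ∀ i : Fin k, ∀ v ∈ (e i).1, v ≠ v₀ := fun i v hv h => by
        have : v ∈ ⋃₀ P := ⟨_, (e i).2, hv⟩
        rw [hP.sUnion_eq] at this
        exact this h
      have hset : ∀ i : Fin k, {v | c v = i.succ} = (e i).1 := by
        intro i
        ext v
        constructor
        · intro h
          obtain ⟨j, hj, hv⟩ := hc' v fun hv => Fin.succ_ne_zero i (h.symm.trans (hc v hv))
          rwa [Fin.succ_injective k (h.symm.trans hj)]
        · intro h
          obtain ⟨j, hj, hv⟩ := hc' v (hne i v h)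
          have := e.injective (Subtype.ext
            (hP.eq_of_mem _ (e i).2 _ (e j).2 v h hv))
          rw [this]
          exact hj
      refine ⟨⟨c, ?_, fun i => ?_⟩, Equiv.ext fun i => Subtype.ext (hset i)⟩
      · refine (Nat.card_eq_one_iff_exists).2 ⟨⟨v₀, hc v₀ rfl⟩, fun ⟨v, hv⟩ => Subtype.ext ?_⟩
        by_contra h
        obtain ⟨i, hi, -⟩ := hc' v h
        exact Fin.succ_ne_zero i (hi.symm.trans hv)
      · rw [hset i]
        exact hP.isBlock _ (e i).2
  refine ⟨Nat.card P, ?_, fun k => ?_⟩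
  · -- distinct blocks contain distinct vertices
    choose f hf using fun p : P => (hP.isBlock p.1 p.2).nonempty
    exact Nat.card_le_card_of_injective f fun p q h =>
      Subtype.ext (hP.eq_of_mem _ p.2 _ q.2 (f p) (hf p) (h ▸ hf q))
  · rw [hcard]
    split_ifs with h
    · have e : Fin k ≃ P := (finCongr h).trans (Finite.equivFin P).symm
      have := Fintype.ofFinite P
      classical
      rw [Nat.card_eq_fintype_card, Fintype.card_equiv e, Fintype.card_fin]
    · have : IsEmpty (Fin k ≃ P) := ⟨fun e => h (by
        rw [← Nat.card_congr e, Nat.card_eq_fintype_card, Fintype.card_fin])⟩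
      exact Nat.card_of_isEmpty

end Diagram

/-! ### Diagrams induced on parts of the vertex set -/

namespace Diagram

variable {V : Type}

/-- The three-valent vertices labelled by `V`, with their half-lines joined by the involution `s`. -/
abbrev wired [Finite V] (s : V × Fin 3 → V × Fin 3) (hs : Function.Involutive s) : Diagram where
  Vert := V
  Leg := V × Fin 3
  finite_vert := inferInstance
  finite_leg := inferInstance
  root := Prod.fst
  join := s
  join_join := hs

/-- The inclusion of the half-lines at the vertices that satisfy `p`. -/
def legVal {p : V → Prop} (x : {v // p v} × Fin 3) : V × Fin 3 := (x.1.1, x.2)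

theorem legVal_injective {p : V → Prop} :
    Function.Injective (legVal : {v // p v} × Fin 3 → V × Fin 3) := by
  rintro ⟨⟨v, hv⟩, a⟩ ⟨⟨w, hw⟩, b⟩ h
  simp only [legVal, Prod.mk.injEq] at h
  obtain ⟨rfl, rfl⟩ := h
  rfl

theorem exists_legVal_eq {p : V → Prop} {l : V × Fin 3} (h : p l.1) :
    ∃ x : {v // p v} × Fin 3, legVal x = l := ⟨(⟨l.1, h⟩, l.2), rfl⟩

/-- The involution `s` extends the involution `τ` of the half-lines at the vertices in `p`, once the
fixed points of `τ` are regarded as undetermined. -/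
def Extends {p : V → Prop} (s : V × Fin 3 → V × Fin 3)
    (τ : {v // p v} × Fin 3 → {v // p v} × Fin 3) : Prop :=
  ∀ x, τ x ≠ x → s (legVal x) = legVal (τ x)

open scoped Classical in
/-- The involution that `s` induces on the half-lines at the vertices in `p`; a half-line whose
partner lies outside becomes a fixed point. -/
def restrictLegs (s : V × Fin 3 → V × Fin 3) (p : V → Prop) (x : {v // p v} × Fin 3) :
    {v // p v} × Fin 3 :=
  if h : p (s (legVal x)).1 then (⟨(s (legVal x)).1, h⟩, (s (legVal x)).2) else x

variable {s : V × Fin 3 → V × Fin 3} {p : V → Prop}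

theorem legVal_restrictLegs {x : {v // p v} × Fin 3} (h : p (s (legVal x)).1) :
    legVal (restrictLegs s p x) = s (legVal x) := by
  rw [restrictLegs, dif_pos h]
  rfl

theorem restrictLegs_of_not {x : {v // p v} × Fin 3} (h : ¬ p (s (legVal x)).1) :
    restrictLegs s p x = x := by
  rw [restrictLegs, dif_neg h]

theorem restrictLegs_eq_self_iff {x : {v // p v} × Fin 3} :
    restrictLegs s p x = x ↔ s (legVal x) = legVal x ∨ ¬ p (s (legVal x)).1 := by
  by_cases h : p (s (legVal x)).1
  · rw [← legVal_injective.eq_iff, legVal_restrictLegs h]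
    simp [h]
  · simp [h, restrictLegs_of_not h]

theorem restrictLegs_involutive (hs : Function.Involutive s) (p : V → Prop) :
    Function.Involutive (restrictLegs s p) := by
  intro x
  by_cases h : p (s (legVal x)).1
  · have h1 := legVal_restrictLegs h
    have h2 : p (s (legVal (restrictLegs s p x))).1 := by
      rw [h1, hs]
      exact x.1.2
    rw [← legVal_injective.eq_iff, legVal_restrictLegs h2, h1, hs]
  · rw [restrictLegs_of_not h, restrictLegs_of_not h]

theorem extends_restrictLegs (s : V × Fin 3 → V × Fin 3) (p : V → Prop) :
    Extends s (restrictLegs s p) := by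
  intro x hx
  by_cases h : p (s (legVal x)).1
  · exact (legVal_restrictLegs h).symm
  · exact (hx (restrictLegs_of_not h)).elim

theorem outer_eq_image [Finite V] (hs : Function.Involutive s) :
    (wired s hs).outer {v | p v} = legVal '' {x : {v // p v} × Fin 3 | restrictLegs s p x = x} := by
  ext l
  constructor
  · rintro ⟨h1, h2⟩
    obtain ⟨x, rfl⟩ := exists_legVal_eq (p := p) h1
    exact ⟨x, restrictLegs_eq_self_iff.2 h2, rfl⟩
  · rintro ⟨x, hx, rfl⟩
    exact ⟨x.1.2, restrictLegs_eq_self_iff.1 hx⟩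

theorem cross_eq_image [Finite V] (hs : Function.Involutive s) (A : Set {v // p v}) :
    (wired s hs).cross (Subtype.val '' A) ({v | p v} \ Subtype.val '' A) =
      legVal '' (wired (restrictLegs s p) (restrictLegs_involutive hs p)).cross A Aᶜ := by
  ext l
  constructor
  · rintro ⟨⟨v, hv, h1⟩, h2, h3⟩
    have hl : p l.1 := by
      have := v.2
      rwa [h1] at this
    obtain ⟨x, rfl⟩ := exists_legVal_eq hl
    obtain rfl : v = x.1 := Subtype.ext h1
    refine ⟨x, ⟨hv, fun h => h3 ⟨_, h, ?_⟩⟩, rfl⟩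
    exact congrArg Prod.fst (legVal_restrictLegs (s := s) h2)
  · rintro ⟨x, ⟨h1, h2⟩, rfl⟩
    have hp : p (s (legVal x)).1 := by
      by_contra h
      refine h2 ?_
      change (restrictLegs s p x).1 ∈ A
      rw [restrictLegs_of_not h]
      exact h1
    have hv := congrArg Prod.fst (legVal_restrictLegs hp)
    refine ⟨⟨x.1, h1, rfl⟩, hp, ?_⟩
    rintro ⟨v, hvA, hv'⟩
    obtain rfl : v = (restrictLegs s p x).1 := Subtype.ext (hv'.trans hv.symm)
    exact h2 hvA

/-- The cut conditions that define a block say that the induced diagram is strongly connected. -/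
theorem isBlock_iff [Finite V] (hs : Function.Involutive s) : (wired s hs).IsBlock {v | p v} ↔
    Nat.card {x : {v // p v} × Fin 3 // restrictLegs s p x = x} = 2 ∧ Nonempty {v // p v} ∧
      (wired (restrictLegs s p) (restrictLegs_involutive hs p)).IsStronglyConnected := by
  have hcard : ((wired s hs).outer {v | p v}).ncard =
      Nat.card {x : {v // p v} × Fin 3 // restrictLegs s p x = x} := by
    rw [outer_eq_image, Set.ncard_image_of_injective _ legVal_injective]
    rfl
  rw [isStronglyConnected_iff]
  constructor
  · rintro ⟨⟨v, hv⟩, h2, h3⟩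
    refine ⟨hcard ▸ h2, ⟨⟨v, hv⟩⟩, fun A hA hA' => ?_⟩
    have hnt := h3 (Subtype.val '' A) (by rintro _ ⟨w, -, rfl⟩; exact w.2) (hA.image _) ?_
    · rw [cross_eq_image hs A] at hnt
      exact (Set.image_nontrivial legVal_injective).1 hnt
    · intro h
      refine hA' (Set.eq_univ_of_forall fun w => ?_)
      obtain ⟨w', hw', h'⟩ : w.1 ∈ Subtype.val '' A := h ▸ w.2
      exact Subtype.ext h' ▸ hw'
  · rintro ⟨h1, ⟨v⟩, h3⟩
    refine ⟨⟨v.1, v.2⟩, hcard.trans h1, fun A hA hne hA' => ?_⟩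
    obtain ⟨B, rfl⟩ : ∃ B : Set {v // p v}, Subtype.val '' B = A := ⟨Subtype.val ⁻¹' A, by
      rw [Set.image_preimage_eq_iff]
      exact hA.trans Subtype.range_coe.symm.subset⟩
    rw [cross_eq_image hs B]
    refine (h3 B (Set.image_nonempty.1 hne) fun h => hA' ?_).image legVal_injective
    rw [h, Set.image_univ]
    exact Subtype.range_coe

/-- In a strongly connected diagram the internal lines of a part with two external lines are all
lines that run inside that part: otherwise its two external lines would be joined to each other,
and no line would leave it. -/
theorem eq_restrictLegs [Finite V] (hs : Function.Involutive s)
    (hsc : (wired s hs).IsStronglyConnected)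
    (hpu : ∃ w, ¬ p w) (hne : Nonempty {v // p v}) {τ : {v // p v} × Fin 3 → {v // p v} × Fin 3}
    (hτ : Function.Involutive τ) (hfix : Nat.card {x // τ x = x} = 2) (hext : Extends s τ) :
    τ = restrictLegs s p := by
  have key : ∀ x, τ x = x → restrictLegs s p x = x := by
    intro x hx
    by_contra hcon
    rw [restrictLegs_eq_self_iff] at hcon
    push Not at hcon
    obtain ⟨h1, h2⟩ := hcon
    obtain ⟨y, hy⟩ := exists_legVal_eq h2
    have hxy : x ≠ y := fun h => h1 (by rw [← hy, h])
    have hτy : τ y = y := by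
      by_contra hne
      have h3 := hext y hne
      rw [hy, hs, legVal_injective.eq_iff] at h3
      exact hxy (by rw [← hx, h3, hτ])
    have hall : ∀ z, τ z = z → z = x ∨ z = y := by
      intro z hz
      obtain ⟨a, b, hab, huniv⟩ := Nat.card_eq_two_iff.1 hfix
      have hmem : ∀ w : {x // τ x = x}, w = a ∨ w = b := fun w => by
        simpa using (huniv ▸ Set.mem_univ w : w ∈ ({a, b} : Set _))
      have hxy' : (⟨x, hx⟩ : {x // τ x = x}) ≠ ⟨y, hτy⟩ := fun h => hxy (congrArg Subtype.val h)
      have : (⟨z, hz⟩ : {x // τ x = x}) = ⟨x, hx⟩ ∨ (⟨z, hz⟩ : {x // τ x = x}) = ⟨y, hτy⟩ := by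
        rcases hmem ⟨x, hx⟩ with h | h <;> rcases hmem ⟨y, hτy⟩ with h' | h' <;>
          rcases hmem ⟨z, hz⟩ with h'' | h'' <;> simp_all
      exact this.imp (congrArg Subtype.val) (congrArg Subtype.val)
    obtain ⟨w, hw⟩ := hpu
    obtain ⟨v⟩ := hne
    obtain ⟨l, hl, hl'⟩ := hsc.exists_mem_cross (A := {v | p v}) ⟨v.1, v.2⟩
      fun h => hw (h ▸ Set.mem_univ w : w ∈ {v | p v})
    obtain ⟨z, rfl⟩ := exists_legVal_eq (p := p) hl
    refine hl' ?_
    change p (s (legVal z)).1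
    by_cases hz : τ z = z
    · rcases hall z hz with rfl | rfl
      · exact h2
      · rw [hy, hs]
        exact x.1.2
    · rw [hext z hz]
      exact (τ z).1.2
  funext x
  by_cases hx : τ x = x
  · rw [hx, key x hx]
  · have h := hext x hx
    have hp : p (s (legVal x)).1 := by
      rw [h]
      exact (τ x).1.2
    rw [← legVal_injective.eq_iff, legVal_restrictLegs hp, h]

end Diagram

/-! ### Choosing the pieces and joining them -/

namespace Diagram

theorem eq_id_of_natCard_fixed {α : Type*} [Finite α] {τ : α → α}
    (h : Nat.card {x // τ x = x} = Nat.card α) : τ = id := by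
  have huniv : {x | τ x = x} = Set.univ :=
    Set.eq_of_subset_of_ncard_le (Set.subset_univ _) (by rw [Set.ncard_univ]; exact h.ge)
  exact funext fun x => (huniv ▸ Set.mem_univ x : x ∈ {x | τ x = x})

variable {V : Type} [Finite V]

/-- The number of lines that stay external in a piece of colour `i`: three for the single vertex of
colour `0`, two for the other pieces. -/
def pieceLegs {k : ℕ} (i : Fin (k + 1)) : ℕ := if i = 0 then 3 else 2

/-- The condition on a piece of colour `i`: to be a single vertex for the colour `0`, to be nonempty
and strongly connected for the other colours. -/
def IsPiece {k : ℕ} (i : Fin (k + 1)) (D : Diagram) : Prop :=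
  if i = 0 then Nat.card D.Vert = 1 else Nonempty D.Vert ∧ D.IsStronglyConnected

/-- For every colour `i`, a joining of the trivalent vertices of colour `i` that leaves `num i` lines
external. -/
abbrev PieceJoining {n : ℕ} (num : Fin n → ℕ) (c : V → Fin n) : Type :=
  ∀ i, (cubic {v // c v = i}).Joining (num i)

/-- For the colour `0`, the only admissible joining leaves all three lines external. -/
theorem isPiece_zero_iff {p : V → Prop} (s : V × Fin 3 → V × Fin 3)
    (τ : (cubic {v // p v}).Joining 3) :
    Nat.card {v // p v} = 1 ∧ Extends s τ.1 ↔ Nat.card {v // p v} = 1 ∧ τ.1 = id := by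
  refine and_congr_right fun hcard => ⟨fun _ => ?_, fun h x hx => (hx (congrFun h x)).elim⟩
  exact eq_id_of_natCard_fixed (τ.2.2.2.trans (by rw [Nat.card_prod, hcard, Nat.card_fin]))

/-- For the other colours, the admissible joining is the one induced by `s`, and the colour class
has to be a block. -/
theorem isPiece_succ_iff {p : V → Prop} {s : V × Fin 3 → V × Fin 3} (hs : Function.Involutive s)
    (hsc : (wired s hs).IsStronglyConnected) (hpu : ∃ w, ¬ p w)
    (τ : (cubic {v // p v}).Joining 2) :
    (Nonempty {v // p v} ∧ ((cubic {v // p v}).joined τ).IsStronglyConnected) ∧ Extends s τ.1 ↔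
      (wired s hs).IsBlock {v | p v} ∧ τ.1 = restrictLegs s p := by
  obtain ⟨τ, hτ, hτ', hcard⟩ := τ
  constructor
  · rintro ⟨⟨hne, hτsc⟩, hext⟩
    obtain rfl := eq_restrictLegs hs hsc hpu hne hτ hcard hext
    exact ⟨(isBlock_iff hs).2 ⟨hcard, hne, hτsc⟩, rfl⟩
  · rintro ⟨hb, rfl⟩
    exact ⟨((isBlock_iff hs).1 hb).2, extends_restrictLegs s p⟩

/-- For a strongly connected diagram, a colouring of its vertices determines the pieces. -/
theorem card_pieceJoining {k : ℕ} (c : V → Fin (k + 1)) {s : V × Fin 3 → V × Fin 3}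
    (hs : Function.Involutive s) (hsc : (wired s hs).IsStronglyConnected) [Decidable
      ((wired s hs).IsBlockColoring c)] :
    Nat.card {t : PieceJoining pieceLegs c // (∀ i, IsPiece i ((cubic {v // c v = i}).joined (t i))) ∧
      ∀ i, Extends s (t i).1} = if (wired s hs).IsBlockColoring c then 1 else 0 := by
  have hpu : Nat.card {v // c v = 0} = 1 → ∀ i : Fin k, ∃ w, ¬ c w = i.succ := by
    intro h i
    obtain ⟨⟨w, hw⟩, -⟩ := (Nat.card_eq_one_iff_exists).1 h
    exact ⟨w, fun h => Fin.succ_ne_zero i (h.symm.trans hw)⟩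
  have hzero : ∀ t : (cubic {v // c v = 0}).Joining (pieceLegs (0 : Fin (k + 1))),
      IsPiece (0 : Fin (k + 1)) ((cubic {v // c v = 0}).joined t) ∧ Extends s t.1 ↔
        Nat.card {v // c v = 0} = 1 ∧ t.1 = id := fun t => isPiece_zero_iff s t
  have hsucc : Nat.card {v // c v = 0} = 1 → ∀ (i : Fin k)
      (t : (cubic {v // c v = i.succ}).Joining (pieceLegs i.succ)),
      IsPiece i.succ ((cubic {v // c v = i.succ}).joined t) ∧ Extends s t.1 ↔
        (wired s hs).IsBlock {v | c v = i.succ} ∧ t.1 = restrictLegs s _ :=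
    fun h i t => isPiece_succ_iff hs hsc (hpu h i) t
  have hiff : ∀ t : PieceJoining pieceLegs c,
      ((∀ i, IsPiece i ((cubic {v // c v = i}).joined (t i))) ∧ ∀ i, Extends s (t i).1) ↔
        (wired s hs).IsBlockColoring c ∧ (t 0).1 = id ∧
          ∀ i : Fin k, (t i.succ).1 = restrictLegs s _ := by
    intro t
    rw [← forall_and, Fin.forall_fin_succ, hzero]
    constructor
    · rintro ⟨⟨h1, h2⟩, h3⟩
      have h4 := fun i => (hsucc h1 i _).1 (h3 i)
      exact ⟨⟨h1, fun i => (h4 i).1⟩, h2, fun i => (h4 i).2⟩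
    · rintro ⟨h1, h2, h3⟩
      exact ⟨⟨h1.1, h2⟩, fun i => (hsucc h1.1 i _).2 ⟨h1.2 i, h3 i⟩⟩
  split_ifs with hc
  · rw [Nat.card_eq_one_iff_unique]
    constructor
    · refine ⟨fun t t' => Subtype.ext (funext fun i => Subtype.ext ?_)⟩
      have h := ((hiff _).1 t.2).2
      have h' := ((hiff _).1 t'.2).2
      induction i using Fin.cases with
      | zero => exact h.1.trans h'.1.symm
      | succ i => exact (h.2 i).trans (h'.2 i).symm
    · have hex : ∀ i, ∃ t : (cubic {v // c v = i}).Joining (pieceLegs i),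
          IsPiece i ((cubic {v // c v = i}).joined t) ∧ Extends s t.1 := by
        intro i
        induction i using Fin.cases with
        | zero =>
          refine ⟨⟨id, fun _ => rfl, fun _ h => (h rfl).elim, ?_⟩, (hzero _).2 ⟨hc.1, rfl⟩⟩
          change Nat.card {x : {v // c v = 0} × Fin 3 // x = x} = 3
          rw [Nat.card_congr (Equiv.subtypeUnivEquiv fun _ => rfl), Nat.card_prod, hc.1,
            Nat.card_fin]
        | succ i =>
          exact ⟨⟨restrictLegs s _, restrictLegs_involutive hs _, fun _ h => (h rfl).elim,
            ((isBlock_iff hs).1 (hc.2 i)).1⟩, (hsucc hc.1 i _).2 ⟨hc.2 i, rfl⟩⟩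
      choose t ht using hex
      exact ⟨t, fun i => (ht i).1, fun i => (ht i).2⟩
  · have : IsEmpty {t : PieceJoining pieceLegs c //
        (∀ i, IsPiece i ((cubic {v // c v = i}).joined (t i))) ∧ ∀ i, Extends s (t i).1} :=
      ⟨fun t => hc ((hiff _).1 t.2).1⟩
    exact Nat.card_of_isEmpty

section Glue

variable {n : ℕ} {num : Fin n → ℕ} {c : V → Fin n}

/-- The involution of all half-lines that is composed of involutions on the pieces. -/
def glueLegs (t : PieceJoining num c) (l : V × Fin 3) : V × Fin 3 :=
  legVal ((t (c l.1)).1 (⟨l.1, rfl⟩, l.2))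

theorem glueLegs_legVal (t : PieceJoining num c) (i : Fin n) (x : {v // c v = i} × Fin 3) :
    glueLegs t (legVal x) = legVal ((t i).1 x) := by
  obtain ⟨⟨v, rfl⟩, a⟩ := x
  rfl

theorem exists_legVal {V : Type} (c : V → Fin n) (l : V × Fin 3) :
    ∃ i, ∃ x : {v // c v = i} × Fin 3, legVal x = l := ⟨c l.1, (⟨l.1, rfl⟩, l.2), rfl⟩

theorem glueLegs_involutive (t : PieceJoining num c) : Function.Involutive (glueLegs t) := by
  intro l
  obtain ⟨i, x, rfl⟩ := exists_legVal c l
  rw [glueLegs_legVal, glueLegs_legVal]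
  exact congrArg legVal ((t i).2.1 x)

/-- The disjoint union of the joined pieces, as a diagram on the original labels. -/
theorem sigma_iso_wired (t : PieceJoining num c) :
    (sigma fun i => (cubic {v // c v = i}).joined (t i)).Iso
      (wired (glueLegs t) (glueLegs_involutive t)) := by
  refine ⟨Equiv.sigmaFiberEquiv c, ⟨fun x => legVal x.2, fun l => ⟨c l.1, ⟨l.1, rfl⟩, l.2⟩, ?_,
    fun _ => rfl⟩, fun _ => rfl, ?_⟩
  · rintro ⟨i, ⟨v, rfl⟩, a⟩
    rfl
  · rintro ⟨i, x⟩
    exact glueLegs_legVal t i x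

theorem extends_glueLegs_iff (t : PieceJoining num c) (s : V × Fin 3 → V × Fin 3) :
    (∀ l, glueLegs t l ≠ l → s l = glueLegs t l) ↔ ∀ i, Extends s (t i).1 := by
  constructor
  · intro h i x hx
    have := h (legVal x) (by rwa [glueLegs_legVal, legVal_injective.ne_iff])
    rwa [glueLegs_legVal] at this
  · intro h l hl
    obtain ⟨i, x, rfl⟩ := exists_legVal c l
    rw [glueLegs_legVal, legVal_injective.ne_iff] at hl
    rw [glueLegs_legVal]
    exact h i x hl

end Glue

end Diagram

open Diagram

open scoped Classical in
/-- The sum of those diagrams with the property `K` that arise from `D` by connecting all but `n`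
external lines in pairs. -/
def sumJoinings (n : ℕ) (K : Diagram → Prop) (D : Diagram) : DiagramAlgebra :=
  ∑ᶠ t : D.Joining n, if K (D.joined t) then diag (D.joined t) else 0

open scoped Classical in
theorem sumJoinings_congr (n : ℕ) {K : Diagram → Prop} (hK : ∀ D E, D.Iso E → (K D ↔ K E))
    {D E : Diagram} (h : D.Iso E) : sumJoinings n K D = sumJoinings n K E := by
  obtain ⟨e, he⟩ := h.joinings n
  refine finsum_eq_of_bijective e e.bijective fun t => ?_
  rw [diag_congr (he t)]
  exact if_congr (hK _ _ (he t)) rfl rfl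

open scoped Classical in
/-- Joining external lines of the diagram of `g` means choosing a joining of the bare vertices that
agrees with `g` on its internal lines. -/
theorem hscDiagram_wired {V : Type} [Finite V] (n : ℕ) (g : V × Fin 3 → V × Fin 3)
    (hg : Function.Involutive g) :
    hscDiagram n (wired g hg) = ∑ᶠ s : (cubic V).Joining n,
      if ∀ l, g l ≠ l → s.1 l = g l then keepStronglyConnected ((cubic V).joined s) else 0 := by
  let e : (wired g hg).Joining n ≃
      {s : (cubic V).Joining n // ∀ l, g l ≠ l → s.1 l = g l} :=
    { toFun := fun s => ⟨⟨s.1, s.2.1, fun _ h => (h rfl).elim, s.2.2.2⟩, s.2.2.1⟩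
      invFun := fun s => ⟨s.1.1, s.1.2.1, s.2, s.1.2.2.2⟩
      left_inv := fun _ => rfl
      right_inv := fun _ => rfl }
  have hcond : (∑ᶠ s : (cubic V).Joining n,
      if ∀ l, g l ≠ l → s.1 l = g l then keepStronglyConnected ((cubic V).joined s) else 0) =
      ∑ᶠ (s : (cubic V).Joining n) (_ : ∀ l, g l ≠ l → s.1 l = g l),
        keepStronglyConnected ((cubic V).joined s) := by
    simp only [finsum_eq_if]
  rw [hcond, ← finsum_subtype_eq_finsum_cond]
  exact finsum_eq_of_bijective e e.bijective fun _ => rfl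

open scoped Classical in
/-- Applying `H^sc_1` to a product of sums over joinings of the pieces: the diagrams that result are
counted by the ways to recover the pieces from them. -/
theorem hsc_prod_sumJoinings {V : Type} [Finite V] {n : ℕ} (num : Fin n → ℕ) (K : Fin n → Diagram → Prop)
    (c : V → Fin n) :
    hsc 1 (∏ i, sumJoinings (num i) (K i) (cubic {v // c v = i})) =
      ∑ᶠ s : (cubic V).Joining 1,
        (Nat.card {t : PieceJoining num c // (∀ i, K i ((cubic {v // c v = i}).joined (t i))) ∧
          ∀ i, Extends s.1 (t i).1} : ℚ) • keepStronglyConnected ((cubic V).joined s) := by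
  have hfin : ∀ i, Fintype ((cubic {v // c v = i}).Joining (num i)) := fun i => Fintype.ofFinite _
  have hfin' : Fintype ((cubic V).Joining 1) := Fintype.ofFinite _
  have hterm : ∀ t : PieceJoining num c,
      hsc 1 (∏ i, if K i ((cubic {v // c v = i}).joined (t i)) then
        diag ((cubic {v // c v = i}).joined (t i)) else 0) =
      ∑ s : (cubic V).Joining 1, if (∀ i, K i ((cubic {v // c v = i}).joined (t i))) ∧
        ∀ i, Extends s.1 (t i).1 then keepStronglyConnected ((cubic V).joined s) else 0 := by
    intro t
    rw [Finset.prod_ite_zero]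
    by_cases hK : ∀ i, K i ((cubic {v // c v = i}).joined (t i))
    · rw [if_pos fun i _ => hK i, prod_diag, diag_congr (sigma_iso_wired t), hsc_diag,
        hscDiagram_wired, finsum_eq_sum_of_fintype]
      refine Finset.sum_congr rfl fun s _ => if_congr ?_ rfl rfl
      rw [extends_glueLegs_iff, and_iff_right hK]
    · rw [if_neg fun h => hK fun i => h i (Finset.mem_univ i), map_zero]
      exact (Finset.sum_eq_zero fun s _ => if_neg fun h => hK h.1).symm
  simp only [sumJoinings, finsum_eq_sum_of_fintype]
  rw [Finset.prod_univ_sum, map_sum, Fintype.piFinset_univ,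
    Finset.sum_congr rfl fun t _ => hterm t, Finset.sum_comm]
  refine Finset.sum_congr rfl fun s _ => ?_
  rw [← Finset.sum_filter, Finset.sum_const, Nat.cast_smul_eq_nsmul, Nat.card_eq_fintype_card,
    Fintype.card_subtype]

/-! ### Coefficients of the two sides -/

open Diagram

theorem isPiece_congr {k : ℕ} (i : Fin (k + 1)) (D E : Diagram) (h : D.Iso E) :
    IsPiece i D ↔ IsPiece i E := by
  unfold IsPiece
  split_ifs
  · obtain ⟨f, -⟩ := h
    rw [Nat.card_congr f]
  · exact ⟨fun k => ⟨h.nonempty_vert k.1, h.isStronglyConnected k.2⟩,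
      fun k => ⟨h.symm.nonempty_vert k.1, h.symm.isStronglyConnected k.2⟩⟩

theorem sumJoinings_three (m : ℕ) :
    sumJoinings 3 (fun D => Nat.card D.Vert = 1) (cubic (Fin m)) =
      if m = 1 then diag (vertex 3) else 0 := by
  unfold sumJoinings
  by_cases hm : m = 1
  · subst hm
    have hid : ∀ t : (cubic (Fin 1)).Joining 3, t.1 = id := fun t =>
      eq_id_of_natCard_fixed (t.2.2.2.trans (by rw [Nat.card_prod, Nat.card_fin, Nat.card_fin]))
    let t₀ : (cubic (Fin 1)).Joining 3 := ⟨id, fun _ => rfl, fun _ h => (h rfl).elim, by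
      change Nat.card {x : Fin 1 × Fin 3 // x = x} = 3
      rw [Nat.card_congr (Equiv.subtypeUnivEquiv fun _ => rfl), Nat.card_prod, Nat.card_fin,
        Nat.card_fin]⟩
    rw [finsum_eq_single _ t₀ fun t ht => (ht (Subtype.ext (hid t))).elim]
    refine (if_pos (Nat.card_fin 1)).trans ?_
    rw [if_pos rfl, ← pow_one (diag (vertex 3)), diag_vertex_pow]
    rfl
  · rw [if_neg hm]
    refine finsum_eq_zero_of_forall_eq_zero fun t => if_neg ?_
    change ¬ Nat.card (Fin m) = 1
    rwa [Nat.card_fin]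

theorem coeff_cubicVertex (m : ℕ) :
    PowerSeries.coeff m cubicVertex = if m = 1 then diag (vertex 3) else 0 := by
  unfold cubicVertex
  rcases m with _ | m
  · simp
  · rw [PowerSeries.coeff_succ_X_mul, PowerSeries.coeff_C]
    simp

theorem hscDiagram_eq_sumJoinings (n : ℕ) (D : Diagram) :
    hscDiagram n D = sumJoinings n (fun D => Nonempty D.Vert ∧ D.IsStronglyConnected) D := by
  refine finsum_congr fun t => ?_
  unfold keepStronglyConnected
  by_cases h : Nonempty (D.joined t).Vert ∧ (D.joined t).IsStronglyConnected
  · rw [if_pos h]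
    exact (if_pos h).symm
  · rw [if_neg h]
    exact (if_neg h).symm

/-- The exponential generating series of the pieces is `ζ` for the colour `0` and `Σ^sc_2` for the
other colours. -/
theorem mk_sumJoinings {k : ℕ} (i : Fin (k + 1)) :
    (PowerSeries.mk fun m => ((m.factorial : ℚ)⁻¹) •
      sumJoinings (pieceLegs i) (IsPiece i) (cubic (Fin m))) =
      if i = 0 then cubicVertex else sigmaTwo := by
  ext1 m
  rw [PowerSeries.coeff_mk]
  split_ifs with hi
  · have h1 : pieceLegs i = 3 := if_pos hi
    have h2 : IsPiece i = fun D => Nat.card D.Vert = 1 := funext fun D => if_pos hi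
    rw [h1, h2, sumJoinings_three, coeff_cubicVertex]
    split_ifs with hm
    · rw [hm, Nat.factorial_one, Nat.cast_one, inv_one, one_smul]
    · rw [smul_zero]
  · have h1 : pieceLegs i = 2 := if_neg hi
    have h2 : IsPiece i = fun D => Nonempty D.Vert ∧ D.IsStronglyConnected :=
      funext fun D => if_neg hi
    rw [h1, h2, coeff_sigmaTwo, hscDiagram_eq_sumJoinings]

open scoped Classical in
theorem natCard_subtype_eq_sum {α : Type*} [Fintype α] (P : α → Prop) :
    Nat.card {a // P a} = ∑ a, if P a then 1 else 0 := by
  rw [Nat.card_eq_fintype_card, Fintype.card_subtype, Finset.card_filter]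

/-- The coefficients of `H^sc_1 (ζ Σ^k)` in terms of block colourings. -/
theorem coeff_hscSeries_mul_pow (k m : ℕ) :
    PowerSeries.coeff m (hscSeries 1 (cubicVertex * sigmaTwo ^ k)) =
      ((m.factorial : ℚ)⁻¹) • ∑ᶠ s : (cubic (Fin m)).Joining 1,
        (Nat.card {c : Fin m → Fin (k + 1) // ((cubic (Fin m)).joined s).IsBlockColoring c} : ℚ) •
          keepStronglyConnected ((cubic (Fin m)).joined s) := by
  classical
  have hprod : cubicVertex * sigmaTwo ^ k = ∏ i : Fin (k + 1), PowerSeries.mk fun m =>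
      ((m.factorial : ℚ)⁻¹) • sumJoinings (pieceLegs i) (IsPiece i) (cubic (Fin m)) := by
    rw [Finset.prod_congr rfl fun i _ => mk_sumJoinings i, Fin.prod_univ_succ]
    simp [Fin.succ_ne_zero]
  have h := coeff_prod_exponential (fun (i : Fin (k + 1)) m =>
    sumJoinings (pieceLegs i) (IsPiece i) (cubic (Fin m))) (Fin m)
  rw [Fintype.card_fin, ← hprod] at h
  have hcongr : ∀ (c : Fin m → Fin (k + 1)) (i : Fin (k + 1)),
      sumJoinings (pieceLegs i) (IsPiece i) (cubic (Fin (Finset.card {v | c v = i}))) =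
      sumJoinings (pieceLegs i) (IsPiece i) (cubic {v // c v = i}) := fun c i =>
    sumJoinings_congr _ (isPiece_congr i) (cubic_congr (Fintype.equivFinOfCardEq
      (Fintype.card_subtype _)).symm)
  have := Fintype.ofFinite ((cubic (Fin m)).Joining 1)
  rw [hscSeries, PowerSeries.coeff_mk, h, map_smul, map_sum]
  congr 1
  simp only [hcongr, hsc_prod_sumJoinings, finsum_eq_sum_of_fintype]
  rw [Finset.sum_comm]
  refine Finset.sum_congr rfl fun s _ => ?_
  rw [← Finset.sum_smul]
  by_cases hsc : ((cubic (Fin m)).joined s).IsStronglyConnected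
  · congr 1
    have hcard : ∀ c : Fin m → Fin (k + 1), Nat.card {t : PieceJoining pieceLegs c //
        (∀ i, IsPiece i ((cubic {v // c v = i}).joined (t i))) ∧ ∀ i, Extends s.1 (t i).1} =
        if ((cubic (Fin m)).joined s).IsBlockColoring c then 1 else 0 :=
      fun c => card_pieceJoining c s.2.1 hsc
    rw [Finset.sum_congr rfl fun c _ => congrArg Nat.cast (hcard c), ← Nat.cast_sum]
    exact congrArg _ (natCard_subtype_eq_sum fun c : Fin m → Fin (k + 1) =>
      ((cubic (Fin m)).joined s).IsBlockColoring c).symm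
  · rw [keepStronglyConnected, if_neg fun h => hsc h.2, smul_zero, smul_zero]

/-- Every diagram of `Γ^sc_1`, given by `s`, arises from exactly one power `Σ^n` with `n = n s`, the
number of its blocks. For an `s` that is not strongly connected, `n s` is irrelevant. -/
theorem exists_coeff_hscSeries_mul_pow (m : ℕ) :
    ∃ n : (cubic (Fin m)).Joining 1 → ℕ, (∀ s, n s ≤ m) ∧ ∀ k : ℕ,
      PowerSeries.coeff m (((k.factorial : ℚ)⁻¹) • hscSeries 1 (cubicVertex * sigmaTwo ^ k)) =
        ((m.factorial : ℚ)⁻¹) • ∑ᶠ s : (cubic (Fin m)).Joining 1,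
          if k = n s then keepStronglyConnected ((cubic (Fin m)).joined s) else 0 := by
  have hdeg : ∀ v : Fin m, {l : Fin m × Fin 3 | l.1 = v}.ncard = 3 := by
    intro v
    have himage : {l : Fin m × Fin 3 | l.1 = v} = Set.range (Prod.mk v) := by
      ext ⟨w, a⟩
      simp [eq_comm]
    rw [himage, ← Set.image_univ, Set.ncard_image_of_injective _ (Prod.mk_right_injective v),
      Set.ncard_univ, Nat.card_fin]
  have hex : ∀ s : (cubic (Fin m)).Joining 1, ∃ n ≤ m, ∀ k : ℕ,
      ((k.factorial : ℚ)⁻¹) • (Nat.card {c : Fin m → Fin (k + 1) //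
        ((cubic (Fin m)).joined s).IsBlockColoring c} : ℚ) •
          keepStronglyConnected ((cubic (Fin m)).joined s) =
        if k = n then keepStronglyConnected ((cubic (Fin m)).joined s) else 0 := by
    intro s
    by_cases hsc : ((cubic (Fin m)).joined s).IsStronglyConnected
    · obtain ⟨n, hn, hcard⟩ := exists_card_isBlockColoring hsc s.2.2.2 hdeg
      refine ⟨n, hn.trans_eq (Nat.card_fin m), fun k => ?_⟩
      have hcard' : Nat.card {c : Fin m → Fin (k + 1) //
        ((cubic (Fin m)).joined s).IsBlockColoring c} = if k = n then k.factorial else 0 := hcard k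
      rw [hcard']
      split_ifs
      · rw [smul_smul, inv_mul_cancel₀ (by positivity), one_smul]
      · rw [Nat.cast_zero, zero_smul, smul_zero]
    · refine ⟨0, Nat.zero_le m, fun k => ?_⟩
      rw [keepStronglyConnected, if_neg fun h => hsc h.2, smul_zero, smul_zero, ite_self]
  choose n hn hcoeff using hex
  refine ⟨n, hn, fun k => ?_⟩
  have := Fintype.ofFinite ((cubic (Fin m)).Joining 1)
  rw [PowerSeries.coeff_smul, coeff_hscSeries_mul_pow, smul_comm, finsum_eq_sum_of_fintype,
    Finset.smul_sum, finsum_eq_sum_of_fintype, Finset.sum_congr rfl fun s _ => hcoeff s k]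

theorem coeff_hscSeries_mul_pow_eq_zero {m k : ℕ} (h : m < k) :
    PowerSeries.coeff m (((k.factorial : ℚ)⁻¹) • hscSeries 1 (cubicVertex * sigmaTwo ^ k)) =
      0 := by
  obtain ⟨n, hn, hcoeff⟩ := exists_coeff_hscSeries_mul_pow m
  rw [hcoeff, finsum_eq_zero_of_forall_eq_zero fun s => if_neg ?_, smul_zero]
  have := hn s
  omega

theorem coeff_gammaOne_eq_sum (m : ℕ) : PowerSeries.coeff m gammaOne =
    ∑ k ∈ Finset.range (m + 1), PowerSeries.coeff m
      (((k.factorial : ℚ)⁻¹) • hscSeries 1 (cubicVertex * sigmaTwo ^ k)) := by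
  obtain ⟨n, hn, hcoeff⟩ := exists_coeff_hscSeries_mul_pow m
  have := Fintype.ofFinite ((cubic (Fin m)).Joining 1)
  rw [coeff_gammaOne, Finset.sum_congr rfl fun k _ => hcoeff k, ← Finset.smul_sum]
  congr 1
  simp only [hscDiagram, finsum_eq_sum_of_fintype]
  rw [Finset.sum_comm]
  refine Finset.sum_congr rfl fun s _ => ?_
  rw [Finset.sum_ite_eq', if_pos (Finset.mem_range.2 (Nat.lt_succ_of_le (hn s)))]

end Feynman

end

theorem mainTheorem5 :
    Feynman.FormallySummable (fun j : ℕ =>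
      (((j + 1).factorial : ℚ)⁻¹) •
        Feynman.hscSeries 1 (Feynman.cubicVertex * Feynman.sigmaTwo ^ (j + 1))) ∧
    Feynman.gammaOne =
      (3 : ℚ) • Feynman.tadpole +
        Feynman.formalSum (fun j : ℕ =>
          (((j + 1).factorial : ℚ)⁻¹) •
            Feynman.hscSeries 1 (Feynman.cubicVertex * Feynman.sigmaTwo ^ (j + 1))) := by
  have hsupp : ∀ m, (Function.support fun j : ℕ => PowerSeries.coeff m
      ((((j + 1).factorial : ℚ)⁻¹) •
        Feynman.hscSeries 1 (Feynman.cubicVertex * Feynman.sigmaTwo ^ (j + 1)))) ⊆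
      (Finset.range m : Set ℕ) := by
    intro m j hj
    by_contra h
    exact hj (Feynman.coeff_hscSeries_mul_pow_eq_zero (by simpa [Nat.lt_succ_iff] using h))
  refine ⟨fun m => (Finset.finite_toSet _).subset (hsupp m), ?_⟩
  ext1 m
  rw [map_add, Feynman.formalSum, PowerSeries.coeff_mk,
    finsum_eq_sum_of_support_subset _ (hsupp m), Feynman.coeff_gammaOne_eq_sum,
    Finset.sum_range_succ', add_comm, pow_zero, mul_one, Nat.factorial_zero, Nat.cast_one, inv_one,
    one_smul, Feynman.hscSeries_cubicVertex]
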